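/- Let $R_{n,k}$ be the set of restricted growth sequences of length $n$ with exactly $k$ different letters, i.e. sequences $\pi=\pi_1\cdots\pi_n$ of positive integers with $\pi_1=1$ and $\pi_{j+1}\le 1+\max\{\pi_1,\dots,\pi_j\}$ for $1\le j<n$, and $|\{\pi_1,\dots,\pi_n\}|=k$. Let $V_\pi$ be the number of pairs $i<j$ with $\pi_\ell<\min\{\pi_i,\pi_j\}$ for all $i<\ell<j$, let $E(V_\pi\mid \pi\in R_{n,k})$ be the mean of $V_\pi$ over the uniform distribution on $R_{n,k}$ (read as $0$ if $R_{n,k}=\emptyset$), and let $S_{n,k}$ be the Stirling numbers of the second kind. Then the double series $$Q(x,y)=\sum_{k\ge1}y^k\sum_{n\ge0}\frac{x^n}{n!}\,S_{n,k}\,E(V_\pi\mid\pi\in R_{n,k})$$ converges absolutely for all $x,y\in\mathbb C$. Put $Ei(1,z)=\int_1^\infty \frac{e^{-zt}}{t}\,dt$ for $\operatorname{Re}z>0$ and $$\begin{aligned}T(x,y)={}&y^3\int_0^x(x-t)e^{ye^t-y}\int_0^tEi(1,ye^r)e^{ye^r+2r}\,dr\,dt\\&+y\int_0^x(t-x)e^{ye^t-y}\bigl(Ei(1,ye^t)e^{ye^t}(ye^t-1)-ye^t\bigr)\,dt\\&+y(1-y)\int_0^x(t-x)e^{ye^t}Ei(1,ye^t)\,dt,\end{aligned}$$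 where $\int_0^x$ is taken along the straight segment from $0$ to $x$. Then for all $x,y\in\mathbb C$ such that $\operatorname{Re}(ye^{sx})>0$ for every $s\in[0,1]$ (in particular for all real $x$ and all real $y>0$), $T(\cdot,y)$ is analytic at $x$, and, with $T_{xx}=\partial^2T/\partial x^2$ the second partial derivative in the first variable, $$Q(x,y)=\frac1y\int_0^xe^{-ye^{x-t}-t}\int_0^te^{ye^{x-r}+r}\,(e^{r-x}+y)\,T_{xx}(r,ye^{x-r})\,dr\,dt .$$ -/

import Mathlib

namespace VisRGS

/-- `π = π₁ ⋯ πₙ` (indexed from `0`) is a restricted growth sequence: its letters are positive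
integers, the first letter is `1`, and every letter is at most `1` plus the maximum of the
preceding ones. -/
def IsRGS {n : ℕ} (π : Fin n → ℕ) : Prop :=
  (∀ i, 1 ≤ π i) ∧ (∀ h : 0 < n, π ⟨0, h⟩ = 1) ∧
    ∀ (j : Fin n) (h : j.val + 1 < n), π ⟨j.val + 1, h⟩ ≤ 1 + (Finset.Iic j).sup π

theorem IsRGS.le_succ {n : ℕ} {π : Fin n → ℕ} (hπ : IsRGS π) :
    ∀ (m : ℕ) (h : m < n), π ⟨m, h⟩ ≤ m + 1 := by
  intro m
  induction m using Nat.strong_induction_on with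
  | _ m ih =>
    intro h
    rcases m with _ | m
    · exact (hπ.2.1 h).le
    · have h1 : π ⟨m + 1, h⟩ ≤ 1 + (Finset.Iic (⟨m, by omega⟩ : Fin n)).sup π :=
        hπ.2.2 ⟨m, by omega⟩ h
      have h2 : (Finset.Iic (⟨m, by omega⟩ : Fin n)).sup π ≤ m + 1 := by
        apply Finset.sup_le
        intro i hi
        have hi' : i.val ≤ m := by simpa [Fin.le_def] using hi
        have := ih i.val (by omega) i.isLt
        simp only [Fin.eta] at this
        omega
      omega

open Classical in
/-- The finite set `R_{n,k}` of all restricted growth sequences of length `n` with exactly `k`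
different letters. The a priori bound `πᵢ ≤ n` only serves finiteness, see `mem_R`. -/
noncomputable def R (n k : ℕ) : Finset (Fin n → ℕ) :=
  (Fintype.piFinset fun _ : Fin n => Finset.Icc 1 n).filter
    fun π => IsRGS π ∧ (Finset.univ.image π).card = k

theorem mem_R {n k : ℕ} {π : Fin n → ℕ} :
    π ∈ R n k ↔ IsRGS π ∧ (Finset.univ.image π).card = k := by
  classical
  unfold R
  rw [Finset.mem_filter]
  constructor
  · intro h
    refine ⟨h.2.1, ?_⟩
    convert h.2.2
  · intro h
    refine ⟨?_, h.1, ?_⟩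
    · rw [Fintype.mem_piFinset]
      intro i
      rw [Finset.mem_Icc]
      have := h.1.le_succ i.val i.isLt
      simp only [Fin.eta] at this
      exact ⟨h.1.1 i, by omega⟩
    · convert h.2

/-- The number `V_π` of strong visible pairs of `π`: pairs `i < j` such that every letter strictly
between positions `i` and `j` is smaller than both `πᵢ` and `πⱼ`. -/
def V {n : ℕ} (π : Fin n → ℕ) : ℕ :=
  (Finset.univ.filter fun p : Fin n × Fin n =>
    p.1 < p.2 ∧ ∀ l, p.1 < l → l < p.2 → π l < min (π p.1) (π p.2)).card

/-- The expectation `E(V_π | π ∈ R_{n,k})` for uniformly distributed `π` (`0` if `R_{n,k} = ∅`). -/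
noncomputable def meanV (n k : ℕ) : ℂ :=
  (∑ π ∈ R n k, (V π : ℂ)) / ((R n k).card : ℂ)

/-- The general term `yᵏ xⁿ/n! S_{n,k} E(V_π | π ∈ R_{n,k})` of the double series. -/
noncomputable def qTerm (x y : ℂ) (k n : ℕ) : ℂ :=
  y ^ k * (x ^ n / (n.factorial : ℂ) * ((Nat.stirlingSecond n k : ℂ) * meanV n k))

/-- `Q(x,y) = ∑_{k ≥ 1} yᵏ ∑_{n ≥ 0} xⁿ/n! S_{n,k} E(V_π | π ∈ R_{n,k})`. -/
noncomputable def Q (x y : ℂ) : ℂ :=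
  ∑' k : ℕ, ∑' n : ℕ, qTerm x y (k + 1) n

/-- The integral `∫₀ˣ f(t) dt` along the straight segment from `0` to `x`. -/
noncomputable def segInt (x : ℂ) (f : ℂ → ℂ) : ℂ :=
  ∫ s in (0 : ℝ)..1, f ((s : ℂ) * x) * x

/-- The exponential integral `Ei(1,z) = ∫₁^∞ e^{-zt}/t dt` (convergent for `Re z > 0`). -/
noncomputable def Ei1 (z : ℂ) : ℂ :=
  ∫ t in Set.Ioi (1 : ℝ), Complex.exp (-z * (t : ℂ)) / (t : ℂ)

open Complex in
/-- The function `T(x,y)`. -/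
noncomputable def T (x y : ℂ) : ℂ :=
  y ^ 3 * segInt x (fun t => (x - t) * exp (y * exp t - y) *
      segInt t (fun r => Ei1 (y * exp r) * exp (y * exp r + 2 * r)))
  + y * segInt x (fun t => (t - x) * exp (y * exp t - y) *
      (Ei1 (y * exp t) * exp (y * exp t) * (y * exp t - 1) - y * exp t))
  + y * (1 - y) * segInt x (fun t => (t - x) * exp (y * exp t) * Ei1 (y * exp t))

/-- The second partial derivative `∂²T/∂x²` at `(x,y)`. -/
noncomputable def Txx (x y : ℂ) : ℂ :=
  iteratedDeriv 2 (fun s => T s y) x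

/-- The points `(x,y)` such that `Re (y e^{sx}) > 0` for all `s ∈ [0,1]`, so that every exponential
integral in the formulas converges. It contains all `(x,y)` with `x` real and `y > 0`. -/
def Dom (x y : ℂ) : Prop :=
  ∀ s : ℝ, 0 ≤ s → s ≤ 1 → 0 < (y * Complex.exp ((s : ℂ) * x)).re

end VisRGS

namespace VisRGS

/-- A sequence extended by one letter is a restricted growth sequence iff the sequence is one and
the new letter exceeds its maximum by at most one. -/
theorem isRGS_snoc {n : ℕ} (π : Fin n → ℕ) (b : ℕ) :
    IsRGS (Fin.snoc π b : Fin (n + 1) → ℕ) ↔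
      IsRGS π ∧ 1 ≤ b ∧ b ≤ 1 + Finset.univ.sup π := by
  have hval : ∀ (m : ℕ) (h : m < n) (h' : m < n + 1),
      (Fin.snoc π b : Fin (n + 1) → ℕ) ⟨m, h'⟩ = π ⟨m, h⟩ := fun m h h' =>
    Fin.snoc_castSucc (α := fun _ => ℕ) b π ⟨m, h⟩
  have hlast : ∀ (h' : n < n + 1), (Fin.snoc π b : Fin (n + 1) → ℕ) ⟨n, h'⟩ = b := fun h' =>
    Fin.snoc_last (α := fun _ => ℕ) b π
  have hsup : ∀ (m : ℕ) (h : m < n) (h' : m < n + 1),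
      (Finset.Iic (⟨m, h'⟩ : Fin (n + 1))).sup (Fin.snoc π b : Fin (n + 1) → ℕ) =
        (Finset.Iic (⟨m, h⟩ : Fin n)).sup π := by
    intro m h h'
    apply le_antisymm
    · refine Finset.sup_le fun i hi => ?_
      have hi' : i.val ≤ m := by simpa [Fin.le_def] using hi
      obtain ⟨i, hi2⟩ := i
      rw [hval i (lt_of_le_of_lt hi' h)]
      exact Finset.le_sup (f := π) (b := ⟨i, lt_of_le_of_lt hi' h⟩) (by simpa [Fin.le_def] using hi')
    · refine Finset.sup_le fun i hi => ?_
      have hi' : i.val ≤ m := by simpa [Fin.le_def] using hi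
      rw [← hval i.val i.isLt (by omega)]
      exact Finset.le_sup (f := (Fin.snoc π b : Fin (n + 1) → ℕ)) (b := ⟨i.val, by omega⟩)
        (by simpa [Fin.le_def] using hi')
  have hfull : ∀ (m : ℕ) (h : m < n), m + 1 = n →
      (Finset.Iic (⟨m, h⟩ : Fin n)).sup π = Finset.univ.sup π := by
    intro m h hm
    congr 1
    ext i
    simp only [Finset.mem_Iic, Fin.le_def, Finset.mem_univ, iff_true]
    omega
  constructor
  · rintro ⟨h1, h2, h3⟩
    refine ⟨⟨fun i => ?_, fun h => ?_, fun j h => ?_⟩, ?_, ?_⟩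
    · rw [← hval i.val i.isLt (by omega)]; exact h1 _
    · rw [← hval 0 h (by omega)]; exact h2 _
    · rw [← hval (j.val + 1) h (by omega), ← hsup j.val j.isLt (by omega)]
      exact h3 ⟨j.val, by omega⟩ (by simp)
    · rw [← hlast (by omega)]; exact h1 _
    · rcases Nat.eq_zero_or_pos n with rfl | hn
      · rw [← hlast (by omega), h2 (by omega)]; omega
      · have := h3 ⟨n - 1, by omega⟩ (by simp; omega)
        rw [hsup (n - 1) (by omega), hfull (n - 1) (by omega) (by omega)] at this
        simp only [Nat.sub_add_cancel hn] at this
        rwa [hlast] at this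
  · rintro ⟨⟨h1, h2, h3⟩, h4, h5⟩
    refine ⟨fun i => ?_, fun h => ?_, fun j h => ?_⟩
    · rcases Nat.lt_or_ge i.val n with hi | hi
      · rw [show i = ⟨i.val, i.isLt⟩ from rfl, hval i.val hi]; exact h1 _
      · have : i = ⟨n, by omega⟩ := Fin.ext (by simp; omega)
        rw [this, hlast]; exact h4
    · rcases Nat.eq_zero_or_pos n with rfl | hn
      · rw [hlast]
        simp at h5
        omega
      · rw [hval 0 hn]; exact h2 hn
    · rcases Nat.lt_or_ge (j.val + 1) n with hj | hj
      · rw [hval (j.val + 1) hj]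
        refine le_of_le_of_eq ?_ (congrArg (1 + ·) (hsup j.val (by omega) j.isLt).symm)
        exact h3 ⟨j.val, by omega⟩ hj
      · have hj' : j.val + 1 = n := by omega
        have e : (⟨j.val + 1, h⟩ : Fin (n + 1)) = ⟨n, by omega⟩ := Fin.ext hj'
        rw [e, hlast, show j = ⟨j.val, j.isLt⟩ from rfl, hsup j.val (by omega),
          hfull j.val (by omega) hj']
        exact h5

theorem image_snoc {n : ℕ} (π : Fin n → ℕ) (b : ℕ) :
    Finset.univ.image (Fin.snoc π b : Fin (n + 1) → ℕ) = insert b (Finset.univ.image π) := by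
  ext a
  simp only [Finset.mem_image, Finset.mem_univ, true_and, Finset.mem_insert]
  constructor
  · rintro ⟨i, rfl⟩
    induction i using Fin.lastCases with
    | last => simp
    | cast i => right; exact ⟨i, by simp⟩
  · rintro (rfl | ⟨i, rfl⟩)
    · exact ⟨Fin.last n, by simp⟩
    · exact ⟨i.castSucc, by simp⟩

theorem sup_snoc {n : ℕ} (π : Fin n → ℕ) (b : ℕ) :
    Finset.univ.sup (Fin.snoc π b : Fin (n + 1) → ℕ) = max b (Finset.univ.sup π) := by
  have h : ∀ {m : ℕ} (σ : Fin m → ℕ), Finset.univ.sup σ = (Finset.univ.image σ).sup id :=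
    fun σ => by rw [Finset.sup_image, Function.id_comp]
  rw [h, image_snoc, Finset.sup_insert, ← h]
  rfl

/-- The letters of a restricted growth sequence are exactly `1, …, max`. -/
theorem IsRGS.image_eq {n : ℕ} {π : Fin n → ℕ} (hπ : IsRGS π) :
    Finset.univ.image π = Finset.Icc 1 (Finset.univ.sup π) := by
  induction n with
  | zero => simp
  | succ n ih =>
    rw [← Fin.snoc_init_self π] at hπ ⊢
    generalize Fin.init π = σ at *
    generalize π (Fin.last n) = b at *
    obtain ⟨h1, h2, h3⟩ := (isRGS_snoc σ b).1 hπ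
    rw [image_snoc, sup_snoc, ih h1]
    ext a
    simp only [Finset.mem_insert, Finset.mem_Icc]
    omega

theorem mem_R_iff_sup {n k : ℕ} {π : Fin n → ℕ} :
    π ∈ R n k ↔ IsRGS π ∧ Finset.univ.sup π = k := by
  rw [mem_R]
  refine and_congr_right fun h => ?_
  rw [h.image_eq, Nat.card_Icc, Nat.add_sub_cancel]

theorem snoc_mem_R {n k : ℕ} {π : Fin n → ℕ} {b : ℕ} :
    (Fin.snoc π b : Fin (n + 1) → ℕ) ∈ R (n + 1) (k + 1) ↔
      (π ∈ R n (k + 1) ∧ b ∈ Finset.Icc 1 (k + 1)) ∨ (π ∈ R n k ∧ b = k + 1) := by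
  simp only [mem_R_iff_sup, isRGS_snoc, sup_snoc, Finset.mem_Icc]
  constructor
  · rintro ⟨⟨h1, h2, h3⟩, h4⟩
    rcases Nat.lt_or_ge k (Finset.univ.sup π) with h | h
    · exact Or.inl ⟨⟨h1, by omega⟩, by omega⟩
    · exact Or.inr ⟨⟨h1, by omega⟩, by omega⟩
  · rintro (⟨⟨h1, h2⟩, h3⟩ | ⟨⟨h1, h2⟩, h3⟩)
    · exact ⟨⟨h1, by omega⟩, by omega⟩
    · exact ⟨⟨h1, by omega⟩, by omega⟩

theorem R_succ_zero (n : ℕ) : R (n + 1) 0 = ∅ := by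
  refine Finset.eq_empty_of_forall_notMem fun π h => ?_
  obtain ⟨h1, h2⟩ := mem_R_iff_sup.1 h
  have := Finset.le_sup (f := π) (Finset.mem_univ 0)
  have := h1.1 0
  omega

theorem R_zero_succ (k : ℕ) : R 0 (k + 1) = ∅ := by
  refine Finset.eq_empty_of_forall_notMem fun π h => ?_
  have := (mem_R_iff_sup.1 h).2
  simp at this

theorem card_R_zero_zero : (R 0 0).card = 1 := by
  rw [Finset.card_eq_one]
  refine ⟨Fin.elim0, ?_⟩
  ext π
  simp only [mem_R_iff_sup, Finset.mem_singleton]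
  refine ⟨fun _ => Subsingleton.elim _ _, fun _ =>
    ⟨⟨fun i => i.elim0, fun h => ?_, fun i => i.elim0⟩, ?_⟩⟩
  · omega
  · simp

/-- Summation over restricted growth sequences by deleting the last letter. -/
theorem sum_R_succ {M : Type*} [AddCommMonoid M] (n k : ℕ) (g : (Fin (n + 1) → ℕ) → M) :
    ∑ σ ∈ R (n + 1) (k + 1), g σ =
      (∑ π ∈ R n (k + 1), ∑ b ∈ Finset.Icc 1 (k + 1), g (Fin.snoc π b)) +
        ∑ π ∈ R n k, g (Fin.snoc π (k + 1)) := by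
  have hdis : Disjoint (R n (k + 1) ×ˢ Finset.Icc 1 (k + 1)) (R n k ×ˢ {k + 1}) := by
    rw [Finset.disjoint_left]
    rintro ⟨π, b⟩ h1 h2
    rw [Finset.mem_product] at h1 h2
    have := (mem_R_iff_sup.1 h1.1).2
    have := (mem_R_iff_sup.1 h2.1).2
    omega
  have h2 : ∑ π ∈ R n k, g (Fin.snoc π (k + 1)) =
      ∑ p ∈ R n k ×ˢ {k + 1}, g (Fin.snoc p.1 p.2) := by
    rw [Finset.sum_product]
    simp
  rw [h2, ← Finset.sum_product' (f := fun π b => g (Fin.snoc π b)), ← Finset.sum_union hdis]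
  symm
  refine Finset.sum_nbij' (fun p => (Fin.snoc p.1 p.2 : Fin (n + 1) → ℕ))
    (fun σ => (Fin.init σ, σ (Fin.last n))) ?_ ?_ ?_ ?_ ?_
  · rintro ⟨π, b⟩ h
    rw [snoc_mem_R]
    simpa [eq_comm] using h
  · intro σ h
    rw [← Fin.snoc_init_self σ, snoc_mem_R] at h
    simpa [eq_comm] using h
  · rintro ⟨π, b⟩ _
    simp
  · intro σ _
    simp
  · intro p _
    rfl

theorem card_R (n k : ℕ) : (R n k).card = Nat.stirlingSecond n k := by
  induction n generalizing k with
  | zero =>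
    cases k with
    | zero => simp [card_R_zero_zero]
    | succ k => simp [R_zero_succ]
  | succ n ih =>
    cases k with
    | zero => simp [R_succ_zero]
    | succ k =>
      rw [Finset.card_eq_sum_ones, sum_R_succ, Nat.stirlingSecond_succ_succ, ← ih, ← ih]
      simp [mul_comm]

/-- The number of positions of `π` that see a letter `b` appended to `π`. -/
def seenBy {n : ℕ} (π : Fin n → ℕ) (b : ℕ) : ℕ :=
  (Finset.univ.filter fun i : Fin n => ∀ l, i < l → π l < min (π i) b).card

/-- The number of positions of `π` with letter `a` after which all letters are below `m`. -/
def tailCount {n : ℕ} (π : Fin n → ℕ) (m a : ℕ) : ℕ :=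
  (Finset.univ.filter fun i : Fin n => π i = a ∧ ∀ l, i < l → π l < m).card

theorem V_snoc {n : ℕ} (π : Fin n → ℕ) (b : ℕ) :
    V (Fin.snoc π b : Fin (n + 1) → ℕ) = V π + seenBy π b := by
  simp only [V, seenBy, Finset.card_filter, Fintype.sum_prod_type_right, Fin.sum_univ_castSucc]
  have hl : ∀ i : Fin n, ¬ Fin.last n < i.castSucc := fun i => not_lt.2 (Fin.le_last _)
  simp [Fin.forall_fin_succ', Fin.castSucc_lt_last, hl]

theorem tailCount_snoc {n : ℕ} (π : Fin n → ℕ) (b m a : ℕ) :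
    tailCount (Fin.snoc π b : Fin (n + 1) → ℕ) m a =
      (if b = a then 1 else 0) + if b < m then tailCount π m a else 0 := by
  simp only [tailCount, Finset.card_filter, Fin.sum_univ_castSucc]
  have hl : ∀ i : Fin n, ¬ Fin.last n < i.castSucc := fun i => not_lt.2 (Fin.le_last _)
  by_cases h : b < m <;> simp [Fin.forall_fin_succ', Fin.castSucc_lt_last, h, hl, add_comm]

theorem seenBy_eq_sum {n k : ℕ} {π : Fin n → ℕ} (hπ : π ∈ R n k) (b : ℕ) :
    seenBy π b = ∑ a ∈ Finset.Icc 1 k, tailCount π (min a b) a := by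
  obtain ⟨h1, h2⟩ := mem_R_iff_sup.1 hπ
  rw [seenBy, Finset.card_eq_sum_card_fiberwise (f := π) (t := Finset.Icc 1 k)]
  · refine Finset.sum_congr rfl fun a _ => ?_
    rw [tailCount, Finset.filter_filter]
    congr 1
    ext i
    simp only [Finset.mem_filter, Finset.mem_univ, true_and]
    constructor
    · rintro ⟨h, rfl⟩; exact ⟨rfl, h⟩
    · rintro ⟨rfl, h⟩; exact ⟨h, rfl⟩
  · intro i _
    simp only [Finset.coe_Icc, Set.mem_Icc]
    exact ⟨h1.1 i, h2 ▸ Finset.le_sup (f := π) (Finset.mem_univ i)⟩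

theorem V_le {n : ℕ} (π : Fin n → ℕ) : V π ≤ n * n := by
  refine (Finset.card_le_univ _).trans ?_
  simp

/-- The total number of strong visible pairs over all of `R_{n,k}`. -/
noncomputable def totalV (n k : ℕ) : ℕ := ∑ π ∈ R n k, V π

/-- The coefficients of `x D_k(x) / (1 - c x)`, where `D_k(x) = ∑ₙ S_{n,k} xⁿ`. -/
def stirlingConv : ℕ → ℕ → ℕ → ℕ
  | 0, _, _ => 0
  | n + 1, k, c => c * stirlingConv n k c + Nat.stirlingSecond n k

/-- The sum of `stirlingConv n k c` over `c < k`. -/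
def convSum (n k : ℕ) : ℕ := ∑ c ∈ Finset.range k, stirlingConv n k c

/-- The sum of `stirlingConv n k (min c d)` over `c, d < k`. -/
def convSumMin (n k : ℕ) : ℕ :=
  ∑ c ∈ Finset.range k, ∑ d ∈ Finset.range k, stirlingConv n k (min c d)

theorem stirlingConv_succ_succ (n k c : ℕ) :
    stirlingConv (n + 1) (k + 1) c = (k + 1) * stirlingConv n (k + 1) c + stirlingConv n k c := by
  induction n with
  | zero => simp [stirlingConv]
  | succ n ih =>
    change c * stirlingConv (n + 1) (k + 1) c + Nat.stirlingSecond (n + 1) (k + 1) =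
      (k + 1) * (c * stirlingConv n (k + 1) c + Nat.stirlingSecond n (k + 1)) +
        (c * stirlingConv n k c + Nat.stirlingSecond n k)
    rw [ih, Nat.stirlingSecond_succ_succ]
    ring

theorem stirlingConv_le (n k c : ℕ) (hc : c ≤ k + 1) :
    stirlingConv n k c ≤ Nat.stirlingSecond n (k + 1) := by
  induction n with
  | zero => simp [stirlingConv]
  | succ n ih =>
    rw [stirlingConv, Nat.stirlingSecond_succ_succ]
    gcongr

theorem convSum_succ_succ (n k : ℕ) :
    convSum (n + 1) (k + 1) =
      (k + 1) * convSum n (k + 1) + convSum n k + stirlingConv n k k := by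
  simp only [convSum, stirlingConv_succ_succ, Finset.sum_add_distrib, ← Finset.mul_sum]
  rw [Finset.sum_range_succ (fun c => stirlingConv n k c) k]
  ring

theorem sum_min_range_succ (k : ℕ) (f : ℕ → ℕ) :
    ∑ c ∈ Finset.range (k + 1), ∑ d ∈ Finset.range (k + 1), f (min c d) =
      ∑ c ∈ Finset.range k, ∑ d ∈ Finset.range k, f (min c d) +
        2 * ∑ c ∈ Finset.range k, f c + f k := by
  have h1 : ∑ c ∈ Finset.range k, f (min c k) = ∑ c ∈ Finset.range k, f c :=
    Finset.sum_congr rfl fun c hc => by rw [min_eq_left (Finset.mem_range.1 hc).le]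
  have h2 : ∑ c ∈ Finset.range k, f (min k c) = ∑ c ∈ Finset.range k, f c :=
    Finset.sum_congr rfl fun c hc => by rw [min_eq_right (Finset.mem_range.1 hc).le]
  simp only [Finset.sum_range_succ, Finset.sum_add_distrib, h1, h2, min_self]
  ring

theorem convSumMin_succ_succ (n k : ℕ) :
    convSumMin (n + 1) (k + 1) =
      (k + 1) * convSumMin n (k + 1) + convSumMin n k + 2 * convSum n k + stirlingConv n k k := by
  simp only [convSumMin, stirlingConv_succ_succ, Finset.sum_add_distrib, ← Finset.mul_sum]
  rw [sum_min_range_succ k (stirlingConv n k), convSum]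
  ring

theorem sum_tailCount (n k m a : ℕ) (hma : m < a) (hak : a ≤ k + 1) :
    ∑ π ∈ R n (k + 1), tailCount π (m + 1) a =
      stirlingConv n (k + 1) m + if a = k + 1 then stirlingConv n k m else 0 := by
  induction n with
  | zero => simp [R_zero_succ, stirlingConv]
  | succ n ih =>
    have hfil : (Finset.Icc 1 (k + 1)).filter (· < m + 1) = Finset.Icc 1 m := by
      ext b
      simp only [Finset.mem_filter, Finset.mem_Icc]
      omega
    have ha : a ∈ Finset.Icc 1 (k + 1) := Finset.mem_Icc.2 ⟨by omega, hak⟩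
    have h1 : ∀ π : Fin n → ℕ, ∑ b ∈ Finset.Icc 1 (k + 1),
        tailCount (Fin.snoc π b : Fin (n + 1) → ℕ) (m + 1) a = 1 + m * tailCount π (m + 1) a := by
      intro π
      simp only [tailCount_snoc, Finset.sum_add_distrib]
      rw [Finset.sum_ite_eq', if_pos ha, ← Finset.sum_filter, hfil]
      simp
    have h2 : ∀ π : Fin n → ℕ, tailCount (Fin.snoc π (k + 1) : Fin (n + 1) → ℕ) (m + 1) a =
        if a = k + 1 then 1 else 0 := by
      intro π
      rw [tailCount_snoc, if_neg (show ¬ k + 1 < m + 1 by omega), add_zero]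
      simp only [eq_comm]
    rw [sum_R_succ]
    simp only [h1, h2, Finset.sum_add_distrib, ← Finset.mul_sum, ih, Finset.sum_const, card_R,
      smul_eq_mul, stirlingConv]
    split_ifs <;> ring

theorem sum_Icc_one (k : ℕ) (f : ℕ → ℕ) :
    ∑ a ∈ Finset.Icc 1 k, f a = ∑ c ∈ Finset.range k, f (c + 1) := by
  rw [Finset.range_eq_Ico, Finset.sum_Ico_add' f 0 k 1]
  rfl

theorem totalV_succ_succ (n k : ℕ) :
    totalV (n + 1) (k + 1) = (k + 1) * totalV n (k + 1) + totalV n k +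
      ((∑ c ∈ Finset.range (k + 1), ∑ d ∈ Finset.range (k + 1),
        ∑ π ∈ R n (k + 1), tailCount π (min d c + 1) (d + 1)) +
      ∑ d ∈ Finset.range k, ∑ π ∈ R n k, tailCount π (d + 1) (d + 1)) := by
  rw [totalV, sum_R_succ]
  simp only [V_snoc, Finset.sum_add_distrib]
  have h1 : ∑ π ∈ R n (k + 1), ∑ b ∈ Finset.Icc 1 (k + 1), seenBy π b =
      ∑ c ∈ Finset.range (k + 1), ∑ d ∈ Finset.range (k + 1),
        ∑ π ∈ R n (k + 1), tailCount π (min d c + 1) (d + 1) := by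
    rw [Finset.sum_congr rfl fun π hπ => Finset.sum_congr rfl fun b _ => seenBy_eq_sum hπ b]
    simp only [sum_Icc_one, Nat.add_min_add_right]
    rw [Finset.sum_comm]
    exact Finset.sum_congr rfl fun c _ => Finset.sum_comm
  have h2 : ∑ π ∈ R n k, seenBy π (k + 1) =
      ∑ d ∈ Finset.range k, ∑ π ∈ R n k, tailCount π (d + 1) (d + 1) := by
    rw [Finset.sum_congr rfl fun π hπ => seenBy_eq_sum hπ (k + 1)]
    simp only [sum_Icc_one, Nat.add_min_add_right]
    rw [Finset.sum_comm]
    refine Finset.sum_congr rfl fun d hd => ?_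
    rw [min_eq_left (Finset.mem_range.1 hd).le]
  rw [h1, h2]
  simp only [totalV, Finset.sum_const, Nat.card_Icc, Nat.add_sub_cancel, smul_eq_mul,
    ← Finset.mul_sum]
  ring

theorem sum_sum_tailCount (n k : ℕ) :
    ∑ c ∈ Finset.range (k + 1), ∑ d ∈ Finset.range (k + 1),
        ∑ π ∈ R n (k + 1), tailCount π (min d c + 1) (d + 1) =
      convSumMin n (k + 1) + convSum n k + stirlingConv n k k := by
  have h : ∀ c ∈ Finset.range (k + 1), ∑ d ∈ Finset.range (k + 1),
      ∑ π ∈ R n (k + 1), tailCount π (min d c + 1) (d + 1) =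
        ∑ d ∈ Finset.range (k + 1), stirlingConv n (k + 1) (min c d) + stirlingConv n k c := by
    intro c hc
    have hc' := Finset.mem_range.1 hc
    rw [Finset.sum_congr rfl fun d hd => sum_tailCount n k (min d c) (d + 1) (by omega)
      (by have := Finset.mem_range.1 hd; omega), Finset.sum_add_distrib]
    congr 1
    · exact Finset.sum_congr rfl fun d _ => by rw [min_comm]
    · simp only [Nat.add_right_cancel_iff]
      rw [Finset.sum_ite_eq', if_pos (by simp), min_eq_right (by omega)]
  rw [Finset.sum_congr rfl h, Finset.sum_add_distrib, Finset.sum_range_succ (stirlingConv n k),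
    convSumMin, convSum]
  ring

theorem sum_tailCount_self (n k : ℕ) :
    ∑ d ∈ Finset.range (k + 1), ∑ π ∈ R n (k + 1), tailCount π (d + 1) (d + 1) =
      convSum n (k + 1) + stirlingConv n k k := by
  rw [Finset.sum_congr rfl fun d hd => sum_tailCount n k d (d + 1) (by omega)
      (by have := Finset.mem_range.1 hd; omega), Finset.sum_add_distrib, convSum]
  simp

theorem totalV_zero_left (k : ℕ) : totalV 0 k = 0 :=
  Finset.sum_eq_zero fun π _ => by simp [V]

theorem totalV_zero_right (n : ℕ) : totalV n 0 = 0 := by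
  cases n with
  | zero => exact totalV_zero_left 0
  | succ n => simp [totalV, R_succ_zero]

theorem totalV_le (n k : ℕ) : totalV n k ≤ n * n * Nat.stirlingSecond n k := by
  rw [totalV, ← card_R, mul_comm, ← smul_eq_mul]
  exact Finset.sum_le_card_nsmul _ _ _ fun π _ => V_le π

/-- A growth condition on double sequences under which the double exponential series below
converges everywhere. -/
def Tame (f : ℕ → ℕ → ℂ) : Prop :=
  ∃ C : ℝ, 1 ≤ C ∧ ∀ n k : ℕ, ‖f n k‖ ≤ C ^ (n + k + 1) * ((k : ℝ) + 1) ^ n / k.factorial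

/-- `shift f n k = f n (k - 1)`, with the value `0` at `k = 0`. -/
def shift (f : ℕ → ℕ → ℂ) : ℕ → ℕ → ℂ
  | _, 0 => 0
  | n, k + 1 => f n k

/-- The action of `∂ₓ - y ∂_y` on the coefficients of the double series. -/
def charDiff (f : ℕ → ℕ → ℂ) : ℕ → ℕ → ℂ := fun n k => f (n + 1) k - k * f n k

/-- The double series `∑ₖ yᵏ ∑ₙ rⁿ/n! f(n,k)`. -/
noncomputable def dser (f : ℕ → ℕ → ℂ) (r y : ℂ) : ℂ :=
  ∑' p : ℕ × ℕ, y ^ p.1 * (r ^ p.2 / (p.2.factorial : ℂ)) * f p.2 p.1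

theorem Tame.summable_real {f : ℕ → ℕ → ℂ} (hf : Tame f) {x y : ℝ} (hx : 0 ≤ x) (hy : 0 ≤ y) :
    Summable fun p : ℕ × ℕ => y ^ p.1 * (x ^ p.2 / (p.2.factorial : ℝ)) * ‖f p.2 p.1‖ := by
  obtain ⟨C, hC, hb⟩ := hf
  have hC0 : 0 ≤ C := by linarith
  have key : Summable fun p : ℕ × ℕ => C * ((y * C) ^ p.1 / (p.1.factorial : ℝ)) *
      ((C * ((p.1 : ℝ) + 1) * x) ^ p.2 / (p.2.factorial : ℝ)) := by
    refine (summable_prod_of_nonneg ?_).2 ⟨fun k => ?_, ?_⟩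
    · intro p
      dsimp only [Pi.zero_apply]
      positivity
    · exact (Real.summable_pow_div_factorial (C * ((k : ℝ) + 1) * x)).mul_left
        (C * ((y * C) ^ k / (k.factorial : ℝ)))
    have : ∀ k : ℕ, ∑' n : ℕ, C * ((y * C) ^ k / (k.factorial : ℝ)) *
        ((C * ((k : ℝ) + 1) * x) ^ n / (n.factorial : ℝ)) =
        (C * Real.exp (C * x)) * ((y * C * Real.exp (C * x)) ^ k / (k.factorial : ℝ)) := by
      intro k
      have he : ∑' n : ℕ, (C * ((k : ℝ) + 1) * x) ^ n / (n.factorial : ℝ) =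
          Real.exp (C * ((k : ℝ) + 1) * x) := by
        rw [Real.exp_eq_exp_ℝ, NormedSpace.exp_eq_tsum_div]
      rw [tsum_mul_left, he, mul_pow (y * C), ← Real.exp_nat_mul,
        show C * ((k : ℝ) + 1) * x = k * (C * x) + C * x by ring, Real.exp_add]
      ring
    simp only [this]
    exact (Real.summable_pow_div_factorial (y * C * Real.exp (C * x))).mul_left
      (C * Real.exp (C * x))
  refine Summable.of_nonneg_of_le (fun p => by positivity) (fun p => ?_) key
  obtain ⟨k, n⟩ := p
  calc y ^ k * (x ^ n / (n.factorial : ℝ)) * ‖f n k‖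
      ≤ y ^ k * (x ^ n / (n.factorial : ℝ)) *
        (C ^ (n + k + 1) * ((k : ℝ) + 1) ^ n / k.factorial) := by gcongr; exact hb n k
    _ = _ := by
        simp only [mul_pow, pow_add, pow_one]
        ring

theorem Tame.summable {f : ℕ → ℕ → ℂ} (hf : Tame f) (r y : ℂ) :
    Summable fun p : ℕ × ℕ => y ^ p.1 * (r ^ p.2 / (p.2.factorial : ℂ)) * f p.2 p.1 := by
  refine Summable.of_norm ?_
  refine (hf.summable_real (norm_nonneg r) (norm_nonneg y)).congr fun p => ?_
  simp

theorem Tame.of_le {f b : ℕ → ℕ → ℂ} (hb : Tame b)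
    (h : ∀ n k : ℕ, ‖f n k‖ ≤ ((n : ℝ) + 1) ^ 2 * ((k : ℝ) + 1) ^ 2 * ‖b n k‖) : Tame f := by
  obtain ⟨C, hC, hb⟩ := hb
  have hp : ∀ n : ℕ, (n : ℝ) + 1 ≤ 2 ^ n := fun n => by
    exact_mod_cast Nat.lt_two_pow_self
  refine ⟨4 * C, by linarith, fun n k => (h n k).trans ?_⟩
  calc ((n : ℝ) + 1) ^ 2 * ((k : ℝ) + 1) ^ 2 * ‖b n k‖
      ≤ (2 ^ n) ^ 2 * (2 ^ k) ^ 2 *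
        (C ^ (n + k + 1) * ((k : ℝ) + 1) ^ n / k.factorial) := by
        gcongr
        exacts [hp n, hp k, hb n k]
    _ = 4 ^ (n + k) * (C ^ (n + k + 1) * ((k : ℝ) + 1) ^ n / k.factorial) := by
        rw [← pow_mul, ← pow_mul, mul_comm n, mul_comm k, pow_mul, pow_mul, pow_add 4 n k]
        norm_num only
    _ ≤ 4 ^ (n + k + 1) * (C ^ (n + k + 1) * ((k : ℝ) + 1) ^ n / k.factorial) := by
        refine mul_le_mul_of_nonneg_right (pow_le_pow_right₀ (by norm_num) (by omega)) ?_
        positivity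
    _ = _ := by rw [mul_pow]; ring

theorem Tame.natCast_mul {f : ℕ → ℕ → ℂ} (hf : Tame f) : Tame fun n k => (k : ℂ) * f n k := by
  refine hf.of_le fun n k => ?_
  rw [norm_mul, Complex.norm_natCast]
  gcongr
  have : (0 : ℝ) ≤ n := n.cast_nonneg
  have : (0 : ℝ) ≤ k := k.cast_nonneg
  nlinarith [mul_nonneg (sq_nonneg ((k : ℝ) + 1)) this, sq_nonneg (n : ℝ),
    mul_nonneg (sq_nonneg ((k : ℝ) + 1)) ‹(0 : ℝ) ≤ n›,
    mul_nonneg (sq_nonneg ((k : ℝ) + 1)) (sq_nonneg (n : ℝ))]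

theorem Tame.add {f g : ℕ → ℕ → ℂ} (hf : Tame f) (hg : Tame g) : Tame (f + g) := by
  obtain ⟨C, hC, hf⟩ := hf
  obtain ⟨D, hD, hg⟩ := hg
  refine ⟨C + D, by linarith, fun n k => ?_⟩
  calc ‖f n k + g n k‖ ≤ ‖f n k‖ + ‖g n k‖ := norm_add_le _ _
    _ ≤ C ^ (n + k + 1) * ((k : ℝ) + 1) ^ n / k.factorial +
        D ^ (n + k + 1) * ((k : ℝ) + 1) ^ n / k.factorial := add_le_add (hf n k) (hg n k)
    _ = (C ^ (n + k + 1) + D ^ (n + k + 1)) * ((k : ℝ) + 1) ^ n / k.factorial := by ring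
    _ ≤ _ := by
        gcongr
        exact pow_add_pow_le (by linarith) (by linarith) (by omega)

theorem Tame.neg {f : ℕ → ℕ → ℂ} (hf : Tame f) : Tame (-f) := by
  obtain ⟨C, hC, hf⟩ := hf
  exact ⟨C, hC, fun n k => by simpa using hf n k⟩

theorem Tame.shift {f : ℕ → ℕ → ℂ} (hf : Tame f) : Tame (shift f) := by
  obtain ⟨C, hC, hf⟩ := hf
  have hp : ∀ n : ℕ, (n : ℝ) + 1 ≤ 2 ^ n := fun n => by
    exact_mod_cast Nat.lt_two_pow_self
  refine ⟨2 * C, by linarith, fun n k => ?_⟩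
  cases k with
  | zero =>
    simp only [VisRGS.shift, norm_zero]
    positivity
  | succ k =>
    refine (hf n k).trans ?_
    calc C ^ (n + k + 1) * ((k : ℝ) + 1) ^ n / k.factorial
        = ((k : ℝ) + 1) * C ^ (n + k + 1) * ((k : ℝ) + 1) ^ n / (k + 1).factorial := by
          rw [Nat.factorial_succ]
          push_cast
          field_simp
      _ ≤ 2 ^ (n + (k + 1) + 1) * C ^ (n + (k + 1) + 1) * (((k + 1 : ℕ) : ℝ) + 1) ^ n /
            (k + 1).factorial := by
          gcongr
          · refine (hp k).trans (pow_le_pow_right₀ (by norm_num) (by omega))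
          · omega
          · linarith
      _ = _ := by rw [mul_pow]

theorem factorial_mul_stirlingSecond_le (n k : ℕ) :
    k.factorial * Nat.stirlingSecond n k ≤ (2 * k) ^ n := by
  induction n generalizing k with
  | zero => cases k <;> simp
  | succ n ih =>
    cases k with
    | zero => simp
    | succ k =>
      calc (k + 1).factorial * Nat.stirlingSecond (n + 1) (k + 1)
          = (k + 1) * ((k + 1).factorial * Nat.stirlingSecond n (k + 1)) +
            (k + 1) * (k.factorial * Nat.stirlingSecond n k) := by
            rw [Nat.stirlingSecond_succ_succ, Nat.factorial_succ]; ring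
        _ ≤ (k + 1) * (2 * (k + 1)) ^ n + (k + 1) * (2 * (k + 1)) ^ n := by
            gcongr
            · exact ih _
            · exact (ih k).trans (Nat.pow_le_pow_left (by omega) n)
        _ = _ := by ring

/-- The Stirling numbers of the second kind as a double sequence of complex numbers. -/
def stirlingSeq : ℕ → ℕ → ℂ := fun n k => (Nat.stirlingSecond n k : ℂ)

theorem tame_stirlingSeq : Tame stirlingSeq := by
  refine ⟨2, by norm_num, fun n k => ?_⟩
  rw [stirlingSeq, Complex.norm_natCast, le_div_iff₀ (by positivity), mul_comm]
  calc ((k.factorial : ℝ) * Nat.stirlingSecond n k) ≤ (2 * k : ℝ) ^ n := by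
        exact_mod_cast factorial_mul_stirlingSecond_le n k
    _ ≤ (2 * (k + 1)) ^ n := by gcongr; linarith
    _ = 2 ^ n * (k + 1) ^ n := by rw [mul_pow]
    _ ≤ _ := by
        gcongr
        · norm_num
        · omega

theorem tame_stirlingSeq_succ : Tame fun n k => stirlingSeq n (k + 1) := by
  refine ⟨2, by norm_num, fun n k => ?_⟩
  simp only [stirlingSeq]
  rw [Complex.norm_natCast, le_div_iff₀ (by positivity), mul_comm]
  calc ((k.factorial : ℝ) * Nat.stirlingSecond n (k + 1))
      ≤ ((k + 1).factorial : ℝ) * Nat.stirlingSecond n (k + 1) := by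
        gcongr
        omega
    _ ≤ (2 * (k + 1)) ^ n := by
        exact_mod_cast factorial_mul_stirlingSecond_le n (k + 1)
    _ = 2 ^ n * (k + 1) ^ n := by rw [mul_pow]
    _ ≤ _ := by
        gcongr
        · norm_num
        · omega

theorem dser_add {f g : ℕ → ℕ → ℂ} (hf : Tame f) (hg : Tame g) (r y : ℂ) :
    dser (f + g) r y = dser f r y + dser g r y := by
  rw [dser, dser, dser, ← (hf.summable r y).tsum_add (hg.summable r y)]
  refine tsum_congr fun p => ?_
  simp only [Pi.add_apply]
  ring

theorem dser_neg (f : ℕ → ℕ → ℂ) (r y : ℂ) : dser (-f) r y = -dser f r y := by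
  rw [dser, dser, ← tsum_neg]
  refine tsum_congr fun p => ?_
  simp only [Pi.neg_apply]
  ring

theorem dser_shift (f : ℕ → ℕ → ℂ) (r y : ℂ) :
    dser (shift f) r y = y * dser f r y := by
  have hinj : Function.Injective fun p : ℕ × ℕ => (p.1 + 1, p.2) := by
    rintro ⟨a, b⟩ ⟨c, d⟩ h
    simp_all
  rw [dser, dser, ← tsum_mul_left, ← hinj.tsum_eq]
  · refine tsum_congr fun p => ?_
    simp only [shift, pow_succ]
    ring
  · rintro ⟨k, n⟩ h
    cases k with
    | zero => simp [shift] at h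
    | succ k => exact ⟨(k, n), rfl⟩

theorem dser_zero_left {f : ℕ → ℕ → ℂ} (hf : ∀ k, f 0 k = 0) (y : ℂ) : dser f 0 y = 0 := by
  rw [dser]
  convert tsum_zero with p
  rcases Nat.eq_zero_or_pos p.2 with h | h
  · simp [h, hf]
  · simp [ne_of_gt h]

/-- Termwise differentiation of the double series along the characteristic `y = w e^{-r}`. -/
theorem Tame.hasDerivAt_dser {f : ℕ → ℕ → ℂ} (hf : Tame f) (w r : ℂ) :
    HasDerivAt (fun z => dser f z (w * Complex.exp (-z)))
      (dser (charDiff f) r (w * Complex.exp (-r))) r := by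
  set F : ℕ × ℕ → ℂ → ℂ := fun p z =>
    (w * Complex.exp (-z)) ^ p.1 * (z ^ p.2 / (p.2.factorial : ℂ)) * f p.2 p.1 with hF
  set U := Metric.ball (0 : ℂ) (‖r‖ + 1) with hU
  have hr : r ∈ U := by simp [hU]
  have hu := hf.summable_real (x := ‖r‖ + 1) (y := ‖w‖ * Real.exp (‖r‖ + 1)) (by positivity)
    (by positivity)
  have hd : ∀ p, DifferentiableOn ℂ (F p) U := fun p => by
    have : Differentiable ℂ (F p) := by
      simp only [hF]
      fun_prop
    exact this.differentiableOn
  have hle : ∀ p z, z ∈ U → ‖F p z‖ ≤ (‖w‖ * Real.exp (‖r‖ + 1)) ^ p.1 *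
      ((‖r‖ + 1) ^ p.2 / (p.2.factorial : ℝ)) * ‖f p.2 p.1‖ := by
    intro p z hz
    have hz' : ‖z‖ < ‖r‖ + 1 := by simpa [hU] using hz
    simp only [hF, norm_mul, norm_pow, norm_div, Complex.norm_natCast, Complex.norm_exp]
    gcongr
    have := Complex.abs_re_le_norm z
    rw [abs_le] at this
    simp only [Complex.neg_re]
    linarith
  have hsum := Complex.hasSum_deriv_of_summable_norm hu hd Metric.isOpen_ball hle hr
  have hdiff := (Complex.differentiableOn_tsum_of_summable_norm hu hd Metric.isOpen_ball
    hle).differentiableAt (Metric.isOpen_ball.mem_nhds hr)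
  set d := deriv (fun z => ∑' p, F p z) r with hdd
  have hderiv : HasDerivAt (fun z => dser f z (w * Complex.exp (-z))) d r := hdiff.hasDerivAt
  suffices h : dser (charDiff f) r (w * Complex.exp (-r)) = d by rwa [h]
  set Y := w * Complex.exp (-r) with hY
  have hterm : ∀ p, deriv (F p) r =
      Y ^ p.1 * (p.2 * r ^ (p.2 - 1) / (p.2.factorial : ℂ)) * f p.2 p.1 -
        Y ^ p.1 * (r ^ p.2 / (p.2.factorial : ℂ)) * (p.1 * f p.2 p.1) := by
    intro p
    have h1 : HasDerivAt (fun z => w * Complex.exp (-z)) (-Y) r := by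
      have := ((hasDerivAt_neg r).cexp).const_mul w
      rwa [show w * (Complex.exp (-r) * -1) = -Y by rw [hY]; ring] at this
    have h2 := ((h1.pow p.1).mul ((hasDerivAt_pow p.2 r).div_const (p.2.factorial : ℂ))).mul_const
      (f p.2 p.1)
    have h3 : (p.1 : ℂ) * Y ^ (p.1 - 1) * Y = p.1 * Y ^ p.1 := by
      rcases Nat.eq_zero_or_pos p.1 with h | h
      · simp [h]
      · rw [mul_assoc, ← pow_succ, Nat.sub_add_cancel h]
    refine h2.deriv.trans ?_
    simp only [Pi.pow_apply, ← hY]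
    linear_combination (-(r ^ p.2 / (p.2.factorial : ℂ)) * f p.2 p.1) * h3
  have hk := hf.natCast_mul.summable r Y
  have h1 : HasSum (fun p : ℕ × ℕ =>
      Y ^ p.1 * (p.2 * r ^ (p.2 - 1) / (p.2.factorial : ℂ)) * f p.2 p.1)
      (d + ∑' p : ℕ × ℕ, Y ^ p.1 * (r ^ p.2 / (p.2.factorial : ℂ)) * (p.1 * f p.2 p.1)) := by
    have h := hsum.add hk.hasSum
    simp only [hterm, sub_add_cancel] at h
    exact h
  have hinj : Function.Injective fun p : ℕ × ℕ => (p.1, p.2 + 1) := by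
    rintro ⟨a, b⟩ ⟨c, d⟩ h
    simp_all
  rw [← hinj.hasSum_iff] at h1
  · have h2 := h1.sub hk.hasSum
    rw [add_sub_cancel_right] at h2
    refine (tsum_congr fun p => ?_).trans h2.tsum_eq
    simp only [charDiff, Function.comp_apply, Nat.factorial_succ, Nat.add_sub_cancel]
    have : ((p.2 : ℂ) + 1) ≠ 0 := Nat.cast_add_one_ne_zero _
    have h' : (p.2.factorial : ℂ) ≠ 0 := Nat.cast_ne_zero.2 (Nat.factorial_ne_zero _)
    push_cast
    field_simp
  · rintro ⟨k, n⟩ h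
    cases n with
    | zero => simp
    | succ n => exact absurd ⟨(k, n), rfl⟩ h

/-- The totals of `V` as a double sequence of complex numbers. -/
noncomputable def totalSeq : ℕ → ℕ → ℂ := fun n k => (totalV n k : ℂ)

/-- The coefficients of `x D_{k-1}(x) / (1 - (k - 1) x)`. -/
def diagSeq : ℕ → ℕ → ℂ := shift fun n k => (stirlingConv n k k : ℂ)

/-- `convSum` as a double sequence of complex numbers. -/
def convSeq : ℕ → ℕ → ℂ := fun n k => (convSum n k : ℂ)

/-- `convSumMin` as a double sequence of complex numbers. -/
def convMinSeq : ℕ → ℕ → ℂ := fun n k => (convSumMin n k : ℂ)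

/-- The common part of `sourceSeq` and `momentSeq`. -/
def coreSeq : ℕ → ℕ → ℂ := convMinSeq + (shift convSeq + shift convSeq) + diagSeq

/-- The inhomogeneity in the recurrence for the totals of `V`. -/
def sourceSeq : ℕ → ℕ → ℂ := coreSeq + shift diagSeq

/-- The coefficients of `T_xx(x,y) / y`. -/
def momentSeq : ℕ → ℕ → ℂ := coreSeq + shift stirlingSeq

theorem charDiff_stirlingSeq : charDiff stirlingSeq = shift stirlingSeq := by
  funext n k
  cases k with
  | zero => simp [charDiff, stirlingSeq, shift]
  | succ k => simp [charDiff, stirlingSeq, shift, Nat.stirlingSecond_succ_succ]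

theorem charDiff_diagSeq : charDiff diagSeq = -diagSeq + shift stirlingSeq := by
  funext n k
  cases k with
  | zero => simp [charDiff, diagSeq, shift]
  | succ k =>
    simp only [charDiff, diagSeq, shift, stirlingConv, stirlingSeq, Pi.add_apply, Pi.neg_apply]
    push_cast
    ring

theorem charDiff_convSeq : charDiff convSeq = shift convSeq + diagSeq := by
  funext n k
  cases k with
  | zero => simp [charDiff, diagSeq, convSeq, convSum, shift]
  | succ k =>
    simp only [charDiff, diagSeq, shift, convSeq, convSum_succ_succ, Pi.add_apply]
    push_cast
    ring

theorem charDiff_convMinSeq :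
    charDiff convMinSeq = shift convMinSeq + (shift convSeq + shift convSeq) + diagSeq := by
  funext n k
  cases k with
  | zero => simp [charDiff, diagSeq, convMinSeq, convSumMin, shift]
  | succ k =>
    simp only [charDiff, diagSeq, shift, convSeq, convMinSeq, convSumMin_succ_succ, Pi.add_apply]
    push_cast
    ring

theorem charDiff_add (f g : ℕ → ℕ → ℂ) : charDiff (f + g) = charDiff f + charDiff g := by
  funext n k
  simp only [charDiff, Pi.add_apply]
  ring

theorem shift_add (f g : ℕ → ℕ → ℂ) : shift (f + g) = shift f + shift g := by
  funext n k
  cases k <;> simp [shift]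

theorem shift_neg (f : ℕ → ℕ → ℂ) : shift (-f) = -shift f := by
  funext n k
  cases k <;> simp [shift]

theorem charDiff_shift (f : ℕ → ℕ → ℂ) : charDiff (shift f) = shift (charDiff f) + -shift f := by
  funext n k
  cases k with
  | zero => simp [charDiff, shift]
  | succ k =>
    simp only [charDiff, shift, Pi.add_apply, Pi.neg_apply]
    push_cast
    ring

theorem charDiff_momentSeq : charDiff momentSeq = shift momentSeq + shift diagSeq := by
  simp only [momentSeq, coreSeq, charDiff_add, charDiff_shift, charDiff_stirlingSeq,
    charDiff_diagSeq, charDiff_convSeq, charDiff_convMinSeq, shift_add]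
  abel

theorem charDiff_sourceSeq :
    charDiff sourceSeq = -sourceSeq + (momentSeq + shift momentSeq) := by
  simp only [momentSeq, sourceSeq, coreSeq, charDiff_add, charDiff_shift,
    charDiff_diagSeq, charDiff_convSeq, charDiff_convMinSeq, shift_add, shift_neg]
  abel

theorem charDiff_totalSeq : charDiff totalSeq = shift totalSeq + sourceSeq := by
  funext n k
  rcases k with _ | _ | k
  · simp [charDiff, totalSeq, totalV_zero_right, sourceSeq, coreSeq, convMinSeq, convSumMin,
      diagSeq, shift]
  · simp only [charDiff, totalSeq, totalV_succ_succ, sum_sum_tailCount, sourceSeq, coreSeq,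
      convMinSeq, diagSeq, convSeq, shift, Pi.add_apply]
    simp [convSum]
    ring
  · simp only [charDiff, totalSeq, totalV_succ_succ, sum_sum_tailCount, sum_tailCount_self,
      sourceSeq, coreSeq, convMinSeq, diagSeq, convSeq, shift, Pi.add_apply]
    push_cast
    ring

theorem tame_totalSeq : Tame totalSeq := by
  refine tame_stirlingSeq.of_le fun n k => ?_
  simp only [totalSeq, stirlingSeq, Complex.norm_natCast]
  calc (totalV n k : ℝ) ≤ n * n * Nat.stirlingSecond n k := by exact_mod_cast totalV_le n k
    _ ≤ _ := by
      refine mul_le_mul_of_nonneg_right ?_ (Nat.cast_nonneg _)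
      have h1 : (1 : ℝ) ≤ ((k : ℝ) + 1) ^ 2 := one_le_pow₀ (by linarith [k.cast_nonneg (α := ℝ)])
      have hn := n.cast_nonneg (α := ℝ)
      nlinarith

theorem tame_diagSeq : Tame diagSeq := by
  refine (tame_stirlingSeq_succ.of_le fun n k => ?_).shift
  simp only [stirlingSeq, Complex.norm_natCast]
  have h : (stirlingConv n k k : ℝ) ≤ Nat.stirlingSecond n (k + 1) := by
    exact_mod_cast stirlingConv_le n k k (by omega)
  refine h.trans (le_mul_of_one_le_left (Nat.cast_nonneg _) ?_)
  exact one_le_mul_of_one_le_of_one_le (one_le_pow₀ (by linarith [n.cast_nonneg (α := ℝ)]))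
    (one_le_pow₀ (by linarith [k.cast_nonneg (α := ℝ)]))

theorem tame_of_le_sq_mul {f : ℕ → ℕ → ℕ}
    (h : ∀ n k, f n k ≤ (k + 1) ^ 2 * Nat.stirlingSecond n (k + 1)) :
    Tame fun n k => (f n k : ℂ) := by
  refine tame_stirlingSeq_succ.of_le fun n k => ?_
  simp only [stirlingSeq, Complex.norm_natCast]
  have h' : (f n k : ℝ) ≤ ((k : ℝ) + 1) ^ 2 * Nat.stirlingSecond n (k + 1) := by
    exact_mod_cast h n k
  rw [mul_assoc]
  exact h'.trans (le_mul_of_one_le_left (by positivity)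
    (one_le_pow₀ (by linarith [n.cast_nonneg (α := ℝ)])))

theorem tame_convSeq : Tame convSeq := by
  refine tame_of_le_sq_mul fun n k => ?_
  calc convSum n k ≤ ∑ _c ∈ Finset.range k, Nat.stirlingSecond n (k + 1) :=
        Finset.sum_le_sum fun c hc => stirlingConv_le n k c (by
          have := Finset.mem_range.1 hc; omega)
    _ = k * Nat.stirlingSecond n (k + 1) := by simp
    _ ≤ _ := Nat.mul_le_mul_right _ (by nlinarith)

theorem tame_convMinSeq : Tame convMinSeq := by
  refine tame_of_le_sq_mul fun n k => ?_
  calc convSumMin n k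
      ≤ ∑ _c ∈ Finset.range k, ∑ _d ∈ Finset.range k, Nat.stirlingSecond n (k + 1) :=
        Finset.sum_le_sum fun c hc => Finset.sum_le_sum fun d _ => stirlingConv_le n k _ (by
          have := Finset.mem_range.1 hc; omega)
    _ = k * k * Nat.stirlingSecond n (k + 1) := by simp [mul_assoc]
    _ ≤ _ := Nat.mul_le_mul_right _ (by nlinarith)

theorem tame_coreSeq : Tame coreSeq :=
  (tame_convMinSeq.add (tame_convSeq.shift.add tame_convSeq.shift)).add tame_diagSeq

theorem tame_sourceSeq : Tame sourceSeq := tame_coreSeq.add tame_diagSeq.shift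

theorem tame_momentSeq : Tame momentSeq := tame_coreSeq.add tame_stirlingSeq.shift

theorem diagSeq_zero (k : ℕ) : diagSeq 0 k = 0 := by
  cases k <;> simp [diagSeq, shift, stirlingConv]

theorem coreSeq_zero (k : ℕ) : coreSeq 0 k = 0 := by
  cases k <;> simp [coreSeq, diagSeq_zero, convMinSeq, convSumMin, convSeq, convSum, shift,
    stirlingConv]

theorem sourceSeq_zero (k : ℕ) : sourceSeq 0 k = 0 := by
  cases k <;> simp [sourceSeq, coreSeq_zero, diagSeq_zero, shift]

theorem totalSeq_zero (k : ℕ) : totalSeq 0 k = 0 := by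
  simp [totalSeq, totalV_zero_left]

theorem dser_stirlingSeq_zero (y : ℂ) : dser stirlingSeq 0 y = 1 := by
  rw [dser, tsum_eq_single (0, 0)]
  · simp [stirlingSeq]
  · rintro ⟨k, n⟩ h
    cases n with
    | zero =>
      cases k with
      | zero => exact absurd rfl h
      | succ k => simp [stirlingSeq]
    | succ n => simp

theorem dser_momentSeq_zero (y : ℂ) : dser momentSeq 0 y = y := by
  rw [momentSeq, dser_add tame_coreSeq tame_stirlingSeq.shift, dser_shift, dser_stirlingSeq_zero,
    dser_zero_left coreSeq_zero, zero_add, mul_one]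

theorem qTerm_eq (x y : ℂ) (k n : ℕ) :
    qTerm x y k n = y ^ k * (x ^ n / (n.factorial : ℂ)) * totalSeq n k := by
  have h : (Nat.stirlingSecond n k : ℂ) * meanV n k = totalSeq n k := by
    rw [meanV, card_R, totalSeq, totalV, Nat.cast_sum]
    rcases Nat.eq_zero_or_pos (Nat.stirlingSecond n k) with h0 | h0
    · rw [← card_R, Finset.card_eq_zero] at h0
      simp [h0]
    · exact mul_div_cancel₀ _ (Nat.cast_ne_zero.2 h0.ne')
  rw [qTerm, h, mul_assoc]

theorem summable_qTerm (x y : ℂ) : Summable fun p : ℕ × ℕ => qTerm x y (p.1 + 1) p.2 := by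
  have hinj : Function.Injective fun p : ℕ × ℕ => (p.1 + 1, p.2) := by
    rintro ⟨a, b⟩ ⟨c, d⟩ h
    simp_all
  refine ((tame_totalSeq.summable x y).comp_injective hinj).congr fun p => ?_
  rw [qTerm_eq, Function.comp_apply]

theorem Q_eq_dser (x y : ℂ) : Q x y = dser totalSeq x y := by
  have hinj : Function.Injective fun p : ℕ × ℕ => (p.1 + 1, p.2) := by
    rintro ⟨a, b⟩ ⟨c, d⟩ h
    simp_all
  rw [Q, ← (summable_qTerm x y).tsum_prod, dser]
  refine Eq.trans ?_ (hinj.tsum_eq ?_)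
  · exact tsum_congr fun p => qTerm_eq x y _ _
  · rintro ⟨k, n⟩ h
    cases k with
    | zero => simp [totalSeq, totalV_zero_right] at h
    | succ k => exact ⟨(k, n), rfl⟩

theorem segInt_congr {x : ℂ} {f g : ℂ → ℂ}
    (h : ∀ s : ℝ, 0 ≤ s → s ≤ 1 → f (s * x) = g (s * x)) : segInt x f = segInt x g := by
  refine intervalIntegral.integral_congr fun s hs => ?_
  rw [Set.uIcc_of_le zero_le_one] at hs
  simp only [h s hs.1 hs.2]

/-- The fundamental theorem of calculus along a segment starting at `0`. -/
theorem segInt_eq_sub {x : ℂ} {f F : ℂ → ℂ}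
    (hF : ∀ s : ℝ, 0 ≤ s → s ≤ 1 → HasDerivAt F (f (s * x)) (s * x))
    (hf : ∀ s : ℝ, 0 ≤ s → s ≤ 1 → ContinuousAt f (s * x)) : segInt x f = F x - F 0 := by
  have hd : ∀ s ∈ Set.uIcc (0 : ℝ) 1,
      HasDerivAt (fun s : ℝ => F (s * x)) (f (s * x) * x) s := by
    intro s hs
    rw [Set.uIcc_of_le zero_le_one] at hs
    have h1 : HasDerivAt (fun s : ℝ => (s : ℂ) * x) x s := by
      simpa using (HasDerivAt.ofReal_comp (hasDerivAt_id s)).mul_const x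
    exact (hF s hs.1 hs.2).comp s h1
  have hc : ContinuousOn (fun s : ℝ => f (s * x) * x) (Set.uIcc 0 1) := by
    intro s hs
    rw [Set.uIcc_of_le zero_le_one] at hs
    refine ContinuousAt.continuousWithinAt (ContinuousAt.mul ?_ continuousAt_const)
    exact ContinuousAt.comp (f := fun s : ℝ => (s : ℂ) * x) (hf s hs.1 hs.2) (by fun_prop)
  rw [segInt, intervalIntegral.integral_eq_sub_of_hasDerivAt hd hc.intervalIntegrable]
  simp

theorem eq_of_hasDerivAt_zero {x : ℂ} {F : ℂ → ℂ}
    (hF : ∀ s : ℝ, 0 ≤ s → s ≤ 1 → HasDerivAt F 0 (s * x)) : F x = F 0 := by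
  have h := segInt_eq_sub (f := fun _ => 0) hF fun _ _ _ => continuousAt_const
  rw [show segInt x (fun _ => 0) = 0 by simp [segInt]] at h
  exact (sub_eq_zero.1 h.symm)

open MeasureTheory in
theorem hasDerivAt_Ei1 {z : ℂ} (hz : 0 < z.re) :
    HasDerivAt Ei1 (-Complex.exp (-z) / z) z := by
  have hz0 : z ≠ 0 := fun h => by simp [h] at hz
  have hmeas : ∀ u : ℂ, AEStronglyMeasurable
      (fun t : ℝ => Complex.exp (-u * (t : ℂ)) / (t : ℂ)) (volume.restrict (Set.Ioi 1)) := by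
    intro u
    refine ContinuousOn.aestronglyMeasurable (fun t ht => ?_) measurableSet_Ioi
    have ht0 : (t : ℂ) ≠ 0 := by
      have : (0 : ℝ) < t := lt_trans one_pos ht
      exact_mod_cast this.ne'
    refine ContinuousAt.continuousWithinAt (ContinuousAt.div (by fun_prop) (by fun_prop) ht0)
  have hexp : ∀ c : ℝ, 0 < c → IntegrableOn (fun t : ℝ => Real.exp (-c * t)) (Set.Ioi 1) :=
    fun c hc => integrableOn_exp_mul_Ioi (by linarith) 1
  have hnorm : ∀ (u : ℂ) (t : ℝ), ‖Complex.exp (-u * (t : ℂ))‖ = Real.exp (-u.re * t) := by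
    intro u t
    rw [Complex.norm_exp]
    simp
  have key := hasDerivAt_integral_of_dominated_loc_of_deriv_le (μ := volume.restrict (Set.Ioi 1))
    (F := fun (u : ℂ) (t : ℝ) => Complex.exp (-u * (t : ℂ)) / (t : ℂ))
    (F' := fun (u : ℂ) (t : ℝ) => -Complex.exp (-u * (t : ℂ)))
    (bound := fun t => Real.exp (-(z.re / 2) * t)) (x₀ := z)
    (s := {u : ℂ | z.re / 2 < u.re})
    ((isOpen_lt continuous_const Complex.continuous_re).mem_nhds (by simp; linarith))
    (Filter.Eventually.of_forall hmeas) ?_ ?_ ?_ (hexp _ (by linarith)) ?_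
  · have h := key.2
    have hi : ∫ t in Set.Ioi (1 : ℝ), -Complex.exp (-z * (t : ℂ)) = -Complex.exp (-z) / z := by
      rw [integral_neg, integral_exp_mul_complex_Ioi (by simpa using hz) 1]
      simp
      field_simp
    rw [hi] at h
    exact h
  · refine Integrable.mono' (hexp z.re hz) (hmeas z) ?_
    refine (ae_restrict_iff' measurableSet_Ioi).2 (Filter.Eventually.of_forall fun t ht => ?_)
    rw [norm_div, hnorm]
    refine div_le_self (Real.exp_pos _).le ?_
    rw [Complex.norm_real, Real.norm_eq_abs]
    exact (le_of_lt ht).trans (le_abs_self t)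
  · exact Continuous.aestronglyMeasurable (by fun_prop)
  · refine (ae_restrict_iff' measurableSet_Ioi).2 (Filter.Eventually.of_forall fun t ht u hu => ?_)
    rw [norm_neg, hnorm]
    have ht' : (0 : ℝ) < t := lt_trans one_pos ht
    have hu' : z.re / 2 < u.re := hu
    gcongr
  · refine (ae_restrict_iff' measurableSet_Ioi).2 (Filter.Eventually.of_forall fun t ht u _ => ?_)
    have ht0 : (t : ℂ) ≠ 0 := by
      have : (0 : ℝ) < t := lt_trans one_pos ht
      exact_mod_cast this.ne'
    have h1 : HasDerivAt (fun u : ℂ => -u * (t : ℂ)) (-(t : ℂ)) u := by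
      simpa using (hasDerivAt_neg u).mul_const (t : ℂ)
    have h2 := h1.cexp.div_const (t : ℂ)
    rwa [show Complex.exp (-u * t) * -(t : ℂ) / t = -Complex.exp (-u * t) by field_simp] at h2

/-- The iterated primitive `∫₀ᶻ (z - t) f(t) dt` of a holomorphic function on a convex open set. -/
theorem exists_second_primitive {C : Set ℂ} (hC : Convex ℝ C) (hCo : IsOpen C) (h0 : (0 : ℂ) ∈ C)
    {f : ℂ → ℂ} (hf : DifferentiableOn ℂ f C) :
    ∃ G G' : ℂ → ℂ, ∀ z ∈ C, segInt z (fun t => (z - t) * f t) = G z ∧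
      HasDerivAt G (G' z) z ∧ HasDerivAt G' (f z) z := by
  obtain ⟨P, hP⟩ := hC.exists_forall_hasDerivWithinAt hf
  replace hP : ∀ a ∈ C, HasDerivAt P (f a) a := fun a ha => (hP a ha).hasDerivAt (hCo.mem_nhds ha)
  obtain ⟨S, hS⟩ := hC.exists_forall_hasDerivWithinAt
    (fun a ha => (hP a ha).differentiableAt.differentiableWithinAt : DifferentiableOn ℂ P C)
  replace hS : ∀ a ∈ C, HasDerivAt S (P a) a := fun a ha => (hS a ha).hasDerivAt (hCo.mem_nhds ha)
  refine ⟨fun z => S z - z * P 0 - S 0, fun z => P z - P 0, fun z hz => ⟨?_, ?_, ?_⟩⟩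
  · have hmem : ∀ s : ℝ, 0 ≤ s → s ≤ 1 → (s : ℂ) * z ∈ C := by
      intro s h1 h2
      have := hC.starConvex h0 hz (sub_nonneg.2 h2) h1 (by ring)
      simpa using this
    have h := segInt_eq_sub (x := z) (f := fun t => (z - t) * f t)
      (F := fun t => (z - t) * P t + S t) ?_ ?_
    · rw [h]
      ring
    · intro s h1 h2
      have hs := hmem s h1 h2
      have := (((hasDerivAt_id (s * z : ℂ)).const_sub z).mul (hP _ hs)).add (hS _ hs)
      refine this.congr_deriv ?_
      simp only [id]
      ring
    · intro s h1 h2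
      have hs := hmem s h1 h2
      exact ContinuousAt.mul (by fun_prop) (hf.differentiableAt (hCo.mem_nhds hs)).continuousAt
  · have := ((hS z hz).sub ((hasDerivAt_id z).mul_const (P 0))).sub_const (S 0)
    simpa using this
  · exact (hP z hz).sub_const _

theorem hasDerivAt_Ei1_mul_exp {y z : ℂ} (h : 0 < (y * Complex.exp z).re) :
    HasDerivAt (fun r => Ei1 (y * Complex.exp r)) (-Complex.exp (-(y * Complex.exp z))) z := by
  have h0 : y * Complex.exp z ≠ 0 := fun h' => by simp [h'] at h
  have h1 : HasDerivAt (fun r => y * Complex.exp r) (y * Complex.exp z) z :=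
    (Complex.hasDerivAt_exp z).const_mul y
  refine ((hasDerivAt_Ei1 h).comp z h1).congr_deriv ?_
  exact div_mul_cancel₀ _ h0

/-- An explicit primitive of `Ei(1, y e^r) e^{y e^r + 2 r}`, up to the factor `y²`. -/
noncomputable def innerPrim (y r : ℂ) : ℂ :=
  (y * Complex.exp r - 1) * (Complex.exp (y * Complex.exp r) * Ei1 (y * Complex.exp r)) +
    y * Complex.exp r - r

theorem hasDerivAt_innerPrim {y z : ℂ} (h : 0 < (y * Complex.exp z).re) :
    HasDerivAt (innerPrim y)
      (y ^ 2 * (Ei1 (y * Complex.exp z) * Complex.exp (y * Complex.exp z + 2 * z))) z := by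
  have h1 : HasDerivAt (fun r => y * Complex.exp r) (y * Complex.exp z) z :=
    (Complex.hasDerivAt_exp z).const_mul y
  have h2 := (((h1.sub_const 1).mul (h1.cexp.mul (hasDerivAt_Ei1_mul_exp h))).add h1).sub
    (hasDerivAt_id z)
  refine h2.congr_deriv ?_
  have e1 : Complex.exp (y * Complex.exp z) * Complex.exp (-(y * Complex.exp z)) = 1 := by
    rw [← Complex.exp_add, add_neg_cancel, Complex.exp_zero]
  have e2 : Complex.exp (y * Complex.exp z + 2 * z) =
      Complex.exp (y * Complex.exp z) * Complex.exp z ^ 2 := by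
    rw [Complex.exp_add, two_mul, Complex.exp_add, pow_two]
  rw [e2, Pi.mul_apply]
  linear_combination (1 - y * Complex.exp z) * e1

theorem segInt_inner {y t : ℂ} (hy : y ≠ 0) (h : Dom t y) :
    segInt t (fun r => Ei1 (y * Complex.exp r) * Complex.exp (y * Complex.exp r + 2 * r)) =
      (innerPrim y t - innerPrim y 0) / y ^ 2 := by
  have key := segInt_eq_sub (x := t) (F := fun r => innerPrim y r / y ^ 2)
    (f := fun r => Ei1 (y * Complex.exp r) * Complex.exp (y * Complex.exp r + 2 * r)) ?_ ?_
  · rw [key]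
    ring
  · intro s h1 h2
    refine ((hasDerivAt_innerPrim (h s h1 h2)).div_const (y ^ 2)).congr_deriv ?_
    field_simp
  · intro s h1 h2
    exact (hasDerivAt_Ei1_mul_exp (h s h1 h2)).continuousAt.mul (by fun_prop)

/-- The closed form of `T_xx(x,y) / y`. -/
noncomputable def moment (x y : ℂ) : ℂ :=
  Complex.exp (y * Complex.exp x - y) * (2 * (y * Complex.exp x) - y - x) +
    (1 - y) * Complex.exp (y * Complex.exp x) * (Ei1 y - Ei1 (y * Complex.exp x))

theorem exists_convex_nhds {x y : ℂ} (h : Dom x y) :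
    ∃ C : Set ℂ, Convex ℝ C ∧ IsOpen C ∧ (0 : ℂ) ∈ C ∧ x ∈ C ∧
      ∀ z ∈ C, 0 < (y * Complex.exp z).re := by
  have hU : IsOpen {z : ℂ | 0 < (y * Complex.exp z).re} :=
    isOpen_lt continuous_const (by fun_prop)
  have hK : IsCompact (segment ℝ (0 : ℂ) x) := by
    rw [segment_eq_image]
    exact isCompact_Icc.image (by fun_prop)
  have hsub : segment ℝ (0 : ℂ) x ⊆ {z : ℂ | 0 < (y * Complex.exp z).re} := by
    rw [segment_eq_image]
    rintro _ ⟨s, hs, rfl⟩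
    simpa using h s hs.1 hs.2
  obtain ⟨δ, hδ, hsubδ⟩ := hK.exists_thickening_subset_open hU hsub
  exact ⟨Metric.thickening δ (segment ℝ 0 x), (convex_segment 0 x).thickening δ,
    Metric.isOpen_thickening, Metric.self_subset_thickening hδ _ (left_mem_segment ℝ 0 x),
    Metric.self_subset_thickening hδ _ (right_mem_segment ℝ 0 x), fun z hz => hsubδ hz⟩

theorem Dom.ne_zero {x y : ℂ} (h : Dom x y) : y ≠ 0 := by
  rintro rfl
  simpa using h 0 le_rfl zero_le_one

theorem analyticAt_T_and_Txx {x y : ℂ} (h : Dom x y) :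
    AnalyticAt ℂ (fun s => T s y) x ∧ Txx x y = y * moment x y := by
  have hy := h.ne_zero
  obtain ⟨C, hC, hCo, h0, hx, hpos⟩ := exists_convex_nhds h
  have hdom : ∀ z ∈ C, Dom z y := by
    intro z hz s h1 h2
    refine hpos _ ?_
    have := hC.starConvex h0 hz (sub_nonneg.2 h2) h1 (by ring)
    simpa using this
  have hEi : DifferentiableOn ℂ (fun t => Ei1 (y * Complex.exp t)) C := fun z hz =>
    (hasDerivAt_Ei1_mul_exp (hpos z hz)).differentiableAt.differentiableWithinAt
  have hIn : DifferentiableOn ℂ (innerPrim y) C := fun z hz =>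
    (hasDerivAt_innerPrim (hpos z hz)).differentiableAt.differentiableWithinAt
  set f₁ : ℂ → ℂ := fun t => Complex.exp (y * Complex.exp t - y) *
    ((innerPrim y t - innerPrim y 0) / y ^ 2) with hf₁
  set f₂ : ℂ → ℂ := fun t => -(Complex.exp (y * Complex.exp t - y) *
    (Ei1 (y * Complex.exp t) * Complex.exp (y * Complex.exp t) * (y * Complex.exp t - 1) -
      y * Complex.exp t)) with hf₂
  set f₃ : ℂ → ℂ := fun t => -(Complex.exp (y * Complex.exp t) * Ei1 (y * Complex.exp t)) with hf₃
  obtain ⟨G₁, G₁', hG₁⟩ := exists_second_primitive hC hCo h0 (f := f₁) (by fun_prop)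
  obtain ⟨G₂, G₂', hG₂⟩ := exists_second_primitive hC hCo h0 (f := f₂) (by fun_prop)
  obtain ⟨G₃, G₃', hG₃⟩ := exists_second_primitive hC hCo h0 (f := f₃) (by fun_prop)
  have hT : ∀ z ∈ C, T z y = y ^ 3 * G₁ z + y * G₂ z + y * (1 - y) * G₃ z := by
    intro z hz
    rw [T, ← (hG₁ z hz).1, ← (hG₂ z hz).1, ← (hG₃ z hz).1]
    congr 1
    · congr 1
      · congr 1
        refine segInt_congr fun s h1 h2 => ?_
        rw [segInt_inner hy, hf₁, mul_assoc]
        refine hdom _ ?_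
        have := hC.starConvex h0 hz (sub_nonneg.2 h2) h1 (by ring)
        simpa using this
      · congr 1
        refine segInt_congr fun s h1 h2 => ?_
        simp only [hf₂]
        ring
    · congr 1
      refine segInt_congr fun s h1 h2 => ?_
      simp only [hf₃]
      ring
  have hev : (fun s => T s y) =ᶠ[nhds x]
      fun z => y ^ 3 * G₁ z + y * G₂ z + y * (1 - y) * G₃ z :=
    Filter.eventuallyEq_of_mem (hCo.mem_nhds hx) hT
  have hd1 : ∀ z ∈ C, HasDerivAt (fun z => y ^ 3 * G₁ z + y * G₂ z + y * (1 - y) * G₃ z)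
      (y ^ 3 * G₁' z + y * G₂' z + y * (1 - y) * G₃' z) z := fun z hz =>
    (((hG₁ z hz).2.1.const_mul _).add ((hG₂ z hz).2.1.const_mul _)).add
      ((hG₃ z hz).2.1.const_mul _)
  have hd2 : ∀ z ∈ C, HasDerivAt (fun z => y ^ 3 * G₁' z + y * G₂' z + y * (1 - y) * G₃' z)
      (y ^ 3 * f₁ z + y * f₂ z + y * (1 - y) * f₃ z) z := fun z hz =>
    (((hG₁ z hz).2.2.const_mul _).add ((hG₂ z hz).2.2.const_mul _)).add
      ((hG₃ z hz).2.2.const_mul _)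
  constructor
  · refine AnalyticAt.congr ?_ hev.symm
    exact DifferentiableOn.analyticAt (s := C)
      (fun z hz => (hd1 z hz).differentiableAt.differentiableWithinAt) (hCo.mem_nhds hx)
  · have hev1 : deriv (fun s => T s y) =ᶠ[nhds x]
        fun z => y ^ 3 * G₁' z + y * G₂' z + y * (1 - y) * G₃' z :=
      hev.deriv.trans
        (Filter.eventuallyEq_of_mem (hCo.mem_nhds hx) fun z hz => (hd1 z hz).deriv)
    rw [Txx, iteratedDeriv_succ, iteratedDeriv_one, hev1.deriv_eq, (hd2 x hx).deriv]
    simp only [hf₁, hf₂, hf₃, innerPrim, moment, Complex.exp_zero, mul_one]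
    have e : Complex.exp (y * Complex.exp x - y) * Complex.exp y =
        Complex.exp (y * Complex.exp x) := by
      rw [← Complex.exp_add, sub_add_cancel]
    rw [← e]
    field_simp
    ring

theorem hasDerivAt_char (w z : ℂ) :
    HasDerivAt (fun z => w * Complex.exp (-z)) (-(w * Complex.exp (-z))) z := by
  have := ((hasDerivAt_neg z).cexp).const_mul w
  exact this.congr_deriv (by ring)

theorem hasDerivAt_Ei1_char {w z : ℂ} (h : 0 < (w * Complex.exp (-z)).re) :
    HasDerivAt (fun z => Ei1 (w * Complex.exp (-z))) (Complex.exp (-(w * Complex.exp (-z)))) z := by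
  have h0 : w * Complex.exp (-z) ≠ 0 := fun h' => by simp [h'] at h
  refine ((hasDerivAt_Ei1 h).comp z (hasDerivAt_char w z)).congr_deriv ?_
  rw [neg_div, neg_mul_neg, div_mul_cancel₀ _ h0]

theorem dser_stirlingSeq_char (w r : ℂ) :
    dser stirlingSeq r (w * Complex.exp (-r)) = Complex.exp (w - w * Complex.exp (-r)) := by
  have h := eq_of_hasDerivAt_zero (x := r) (F := fun z => Complex.exp (w * Complex.exp (-z)) *
    dser stirlingSeq z (w * Complex.exp (-z))) fun s _ _ => by
      refine ((hasDerivAt_char w _).cexp.mul (tame_stirlingSeq.hasDerivAt_dser w _)).congr_deriv ?_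
      rw [charDiff_stirlingSeq, dser_shift]
      ring
  simp only [neg_zero, Complex.exp_zero, mul_one, dser_stirlingSeq_zero] at h
  rw [Complex.exp_sub, ← h, mul_div_cancel_left₀ _ (Complex.exp_ne_zero _)]

theorem dser_diagSeq_char {w r : ℂ}
    (h : ∀ s : ℝ, 0 ≤ s → s ≤ 1 → 0 < (w * Complex.exp (-(s * r))).re) :
    dser diagSeq r (w * Complex.exp (-r)) =
      w * Complex.exp (-r) * Complex.exp w * (Ei1 (w * Complex.exp (-r)) - Ei1 w) := by
  have hk := eq_of_hasDerivAt_zero (x := r) (F := fun z => Complex.exp z *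
    dser diagSeq z (w * Complex.exp (-z)) -
      w * Complex.exp w * Ei1 (w * Complex.exp (-z))) fun s h1 h2 => by
      refine (((Complex.hasDerivAt_exp _).mul (tame_diagSeq.hasDerivAt_dser w _)).sub
        ((hasDerivAt_Ei1_char (h s h1 h2)).const_mul _)).congr_deriv ?_
      rw [charDiff_diagSeq, dser_add (tame_diagSeq.neg) tame_stirlingSeq.shift, dser_neg,
        dser_shift, dser_stirlingSeq_char, sub_eq_add_neg w, Complex.exp_add]
      have e : Complex.exp (s * r) * Complex.exp (-(s * r)) = 1 := by
        rw [← Complex.exp_add, add_neg_cancel, Complex.exp_zero]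
      linear_combination
        (w * Complex.exp w * Complex.exp (-(w * Complex.exp (-(s * r))))) * e
  simp only [neg_zero, Complex.exp_zero, mul_one, dser_zero_left diagSeq_zero] at hk
  have e : Complex.exp (-r) * Complex.exp r = 1 := by
    rw [← Complex.exp_add, neg_add_cancel, Complex.exp_zero]
  linear_combination Complex.exp (-r) * hk - dser diagSeq r (w * Complex.exp (-r)) * e

theorem dser_momentSeq_char {w r : ℂ}
    (h : ∀ s : ℝ, 0 ≤ s → s ≤ 1 → 0 < (w * Complex.exp (-(s * r))).re) :
    dser momentSeq r (w * Complex.exp (-r)) = moment r (w * Complex.exp (-r)) := by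
  have hk := eq_of_hasDerivAt_zero (x := r) (F := fun z => Complex.exp (w * Complex.exp (-z)) *
    dser momentSeq z (w * Complex.exp (-z)) -
      (Complex.exp w * (2 * w - w * Complex.exp (-z) - z) +
        (1 - w * Complex.exp (-z)) * Complex.exp (w * Complex.exp (-z)) *
          (Complex.exp w * (Ei1 (w * Complex.exp (-z)) - Ei1 w)))) fun s h1 h2 => by
      have hc := hasDerivAt_char w (s * r)
      refine ((hc.cexp.mul (tame_momentSeq.hasDerivAt_dser w _)).sub
        ((((hc.const_sub (2 * w)).sub (hasDerivAt_id _)).const_mul _).add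
          (((hc.const_sub 1).mul hc.cexp).mul
            (((hasDerivAt_Ei1_char (h s h1 h2)).sub_const _).const_mul _)))).congr_deriv ?_
      rw [charDiff_momentSeq, dser_add tame_momentSeq.shift tame_diagSeq.shift, dser_shift,
        dser_shift, dser_diagSeq_char]
      · have e : Complex.exp (w * Complex.exp (-(s * r))) *
            Complex.exp (-(w * Complex.exp (-(s * r)))) = 1 := by
          rw [← Complex.exp_add, add_neg_cancel, Complex.exp_zero]
        simp only [Pi.mul_apply]
        linear_combination (-(1 - w * Complex.exp (-(s * r))) * Complex.exp w) * e
      · intro s' h1' h2'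
        have := h (s' * s) (by positivity) (by nlinarith)
        rwa [Complex.ofReal_mul, mul_assoc] at this
  simp only [neg_zero, Complex.exp_zero, mul_one, dser_momentSeq_zero] at hk
  have e : w * Complex.exp (-r) * Complex.exp r = w := by
    rw [mul_assoc, ← Complex.exp_add, neg_add_cancel, Complex.exp_zero, mul_one]
  have hne := Complex.exp_ne_zero (w * Complex.exp (-r))
  rw [moment, e]
  refine mul_left_cancel₀ hne ?_
  have e2 : Complex.exp (w * Complex.exp (-r)) * Complex.exp (w - w * Complex.exp (-r)) =
      Complex.exp w := by
    rw [← Complex.exp_add, add_sub_cancel]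
  linear_combination hk - (2 * w - w * Complex.exp (-r) - r) * e2

/-- `(∂ₓ - y ∂_y) Q` along the characteristic through `(0, w)`. -/
noncomputable def charDerivQ (w z : ℂ) : ℂ :=
  w * Complex.exp (-z) * dser totalSeq z (w * Complex.exp (-z)) +
    dser sourceSeq z (w * Complex.exp (-z))

theorem hasDerivAt_dser_totalSeq (w z : ℂ) :
    HasDerivAt (fun z => dser totalSeq z (w * Complex.exp (-z))) (charDerivQ w z) z := by
  refine (tame_totalSeq.hasDerivAt_dser w z).congr_deriv ?_
  rw [charDiff_totalSeq, dser_add tame_totalSeq.shift tame_sourceSeq, dser_shift, charDerivQ]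

theorem hasDerivAt_charDerivQ (w z : ℂ) :
    HasDerivAt (charDerivQ w) ((w * Complex.exp (-z) - 1) * charDerivQ w z +
      (1 + w * Complex.exp (-z)) * dser momentSeq z (w * Complex.exp (-z))) z := by
  refine (((hasDerivAt_char w z).mul (hasDerivAt_dser_totalSeq w z)).add
    (tame_sourceSeq.hasDerivAt_dser w z)).congr_deriv ?_
  rw [charDiff_sourceSeq, dser_add tame_sourceSeq.neg (tame_momentSeq.add tame_momentSeq.shift),
    dser_add tame_momentSeq tame_momentSeq.shift, dser_neg, dser_shift]
  simp only [charDerivQ]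
  ring

theorem charDerivQ_zero (w : ℂ) : charDerivQ w 0 = 0 := by
  simp [charDerivQ, dser_zero_left totalSeq_zero, dser_zero_left sourceSeq_zero]

theorem segInt_moment (y w t : ℂ) :
    segInt t (fun r => Complex.exp (w * Complex.exp (-r) + r) * (y * ((1 + w * Complex.exp (-r)) *
      dser momentSeq r (w * Complex.exp (-r))))) =
      Complex.exp (w * Complex.exp (-t) + t) * (y * charDerivQ w t) := by
  have h := segInt_eq_sub (x := t) (F := fun z => Complex.exp (w * Complex.exp (-z) + z) *
      (y * charDerivQ w z))
    (f := fun r => Complex.exp (w * Complex.exp (-r) + r) * (y * ((1 + w * Complex.exp (-r)) *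
      dser momentSeq r (w * Complex.exp (-r))))) ?_ ?_
  · rw [h, charDerivQ_zero]
    ring
  · intro s _ _
    refine ((((hasDerivAt_char w _).add (hasDerivAt_id _)).cexp).mul
      ((hasDerivAt_charDerivQ w _).const_mul y)).congr_deriv ?_
    simp only [Pi.add_apply, id]
    ring
  · intro s _ _
    have := (tame_momentSeq.hasDerivAt_dser w (s * t)).continuousAt
    exact ContinuousAt.mul (by fun_prop)
      (continuousAt_const.mul (ContinuousAt.mul (by fun_prop) this))

theorem Q_eq_segInt {x y : ℂ} (h : Dom x y) :
    Q x y = 1 / y * segInt x (fun t => Complex.exp (-y * Complex.exp (x - t) - t) *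
      segInt t (fun r => Complex.exp (y * Complex.exp (x - r) + r) * (Complex.exp (r - x) + y) *
        Txx r (y * Complex.exp (x - r)))) := by
  have hy := h.ne_zero
  set w := y * Complex.exp x with hw
  have hY : ∀ r : ℂ, y * Complex.exp (x - r) = w * Complex.exp (-r) := fun r => by
    rw [hw, sub_eq_add_neg, Complex.exp_add, mul_assoc]
  have hinner : ∀ s : ℝ, 0 ≤ s → s ≤ 1 →
      Complex.exp (-y * Complex.exp (x - s * x) - s * x) *
        segInt (s * x) (fun r => Complex.exp (y * Complex.exp (x - r) + r) *
          (Complex.exp (r - x) + y) * Txx r (y * Complex.exp (x - r))) =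
        y * charDerivQ w (s * x) := by
    intro s h1 h2
    have hseg : ∀ s' : ℝ, 0 ≤ s' → s' ≤ 1 → 0 < (w * Complex.exp (-(s' * x))).re := by
      intro s' h1' h2'
      have := h (1 - s') (by linarith) (by linarith)
      rw [← hY]
      convert this using 4
      push_cast
      ring
    rw [segInt_congr (g := fun r => Complex.exp (w * Complex.exp (-r) + r) *
      (y * ((1 + w * Complex.exp (-r)) * dser momentSeq r (w * Complex.exp (-r))))), segInt_moment]
    · rw [← mul_assoc, ← Complex.exp_add, neg_mul, hY]
      simp
    · intro s' h1' h2'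
      set r : ℂ := s' * (s * x) with hr
      have hr' : r = ((s' * s : ℝ) : ℂ) * x := by rw [hr]; push_cast; ring
      have hmem : 0 ≤ s' * s ∧ s' * s ≤ 1 := ⟨by positivity, by nlinarith⟩
      have hdom : Dom r (y * Complex.exp (x - r)) := by
        intro a ha1 ha2
        have := hseg ((1 - a) * (s' * s)) (mul_nonneg (by linarith) hmem.1)
          (by nlinarith [mul_nonneg ha1 hmem.1])
        rw [hY, mul_assoc, ← Complex.exp_add, hr']
        convert this using 4
        push_cast
        ring
      have hm : dser momentSeq r (w * Complex.exp (-r)) = moment r (w * Complex.exp (-r)) := by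
        refine dser_momentSeq_char fun a ha1 ha2 => ?_
        have := hseg (a * (s' * s)) (mul_nonneg ha1 hmem.1) (by nlinarith [hmem.1, hmem.2])
        rwa [Complex.ofReal_mul, mul_assoc (a : ℂ), ← hr'] at this
      have e : Complex.exp (r - x) * (y * Complex.exp (x - r)) = y := by
        rw [mul_left_comm, ← Complex.exp_add]
        simp
      rw [(analyticAt_T_and_Txx hdom).2]
      rw [hY] at e ⊢
      rw [← hm]
      linear_combination (Complex.exp (w * Complex.exp (-r) + r) *
        dser momentSeq r (w * Complex.exp (-r))) * e
  rw [segInt_congr (g := fun z => y * charDerivQ w z) hinner,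
    segInt_eq_sub (F := fun z => y * dser totalSeq z (w * Complex.exp (-z)))]
  · rw [dser_zero_left totalSeq_zero, ← hY, sub_self, Complex.exp_zero, mul_one, Q_eq_dser]
    field_simp
    ring
  · exact fun s _ _ => (hasDerivAt_dser_totalSeq w _).const_mul y
  · exact fun s _ _ => continuousAt_const.mul (hasDerivAt_charDerivQ w _).continuousAt

end VisRGS

theorem theorem1 :
    (∀ x y : ℂ, Summable fun p : ℕ × ℕ => VisRGS.qTerm x y (p.1 + 1) p.2) ∧
    ∀ x y : ℂ, VisRGS.Dom x y →
      AnalyticAt ℂ (fun s => VisRGS.T s y) x ∧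
      VisRGS.Q x y =
        1 / y * VisRGS.segInt x (fun t =>
          Complex.exp (-y * Complex.exp (x - t) - t) *
          VisRGS.segInt t (fun r =>
            Complex.exp (y * Complex.exp (x - r) + r) * (Complex.exp (r - x) + y) *
              VisRGS.Txx r (y * Complex.exp (x - r)))) := by
  refine ⟨VisRGS.summable_qTerm, fun x y h => ⟨?_, VisRGS.Q_eq_segInt h⟩⟩
  exact (VisRGS.analyticAt_T_and_Txx h).1
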